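/- Let $\varphi\colon\Gamma\to G$ be a homomorphism of finite groups. Definitions. A normal map (crossed module) $n\colon M\to H$ is a homomorphism together with an action of $H$ on $M$ by automorphisms such that $n({}^{h}m)=h\,n(m)\,h^{-1}$ and ${}^{n(m)}m'=m\,m'\,m^{-1}$. The free normal closure of a homomorphism $\alpha\colon\Lambda\to H$ is the universal (initial) factorization $\Lambda\to\Lambda^{\alpha}\to H$ of $\alpha$ whose second map is a normal map; morphisms of such factorizations are the homomorphisms compatible with the maps from $\Lambda$, the maps to $H$ and the actions of $H$. The normal closures tower of $\alpha$ is given by $\Lambda_{1,\alpha}=H$, $\alpha_1=\alpha$, where $\Lambda\xrightarrow{\alpha_{i+1}}\Lambda_{i+1,\alpha}\to\Lambda_{i,\alpha}$ is the free normal closure of $\alpha_i\colon\Lambda\to\Lambda_{i,\alpha}$. Put $\Lambda_{\infty,\alpha}=\varprojlim_i\Lambda_{i,\alpha}$, and let $\alpha_\infty\colon\Lambda\to\Lambda_{\infty,\alpha}$ be the induced map. The tower terminates at $t$ if the maps $\Lambda_{i+1,\alpha}\to\Lambda_{i,\alpha}$ are isomorphisms for all $i\ge t$. Let $C_0=G$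 and let $C_{i+1}=\langle\varphi(\Gamma)^{C_i}\rangle$ be the normal closure of $\varphi(\Gamma)$ in $C_i$; let $K_1=\ker\varphi$ and $K_{i+1}=[\Gamma,K_i]$. As $\Gamma$ and $G$ are finite, both decreasing series become constant; let $\mathcal C$ (the subnormal closure of $\varphi(\Gamma)$ in $G$) and $\mathcal K$ be their respective terminal members. Let $\rho\colon\Gamma\to\mathcal C$ and $\psi\colon\Gamma/\mathcal K\to\mathcal C$ be the maps induced by $\varphi$. Then: 1. There is an isomorphism $\Gamma_{\infty,\varphi}\cong\Gamma_{\infty,\rho}$ compatible with $\varphi_\infty$ and $\rho_\infty$ and with the maps to $G$; and $\Gamma_{\infty,\rho}=(\Gamma/\mathcal K)_{\infty,\psi}$, in the sense that there are isomorphisms $\Gamma_{i,\rho}\cong(\Gamma/\mathcal K)_{i,\psi}$ for all $i\ge 1$, equal to the identity of $\mathcal C$ for $i=1$ and compatible with the structure maps of the towers and with the maps $\rho_i$ and $\psi_i$, which therefore induce an isomorphism of the inverse limits. 2. The towers $\{\Gamma_{i,\rho}\}$ and $\{(\Gamma/\mathcal K)_{i,\psi}\}$ terminate, and whenever they terminate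 at $t_1$ and $t_2$ respectively, the isomorphisms of part 1 followed by the projections from the inverse limits give isomorphisms $\Gamma_{\infty,\varphi}\cong\Gamma_{t_1,\rho}$ and $\Gamma_{\infty,\varphi}\cong(\Gamma/\mathcal K)_{t_2,\psi}$. 3. $\Gamma_{\infty,\varphi}$ is finite and $|\Gamma_{\infty,\varphi}|\le|\Gamma/\mathcal K|\cdot g(|\mathcal C|)$, where $g(1)=1$ and, for an integer $t\ge 2$ with least prime divisor $p$, $g(t)=t^{(\log_p t+1)/2}$. -/

import Mathlib

universe u v w

noncomputable section

namespace SubnormalTower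

/-- A normal map (crossed module) `M → G`: a homomorphism `hom` with an action of `G` on `M` by
automorphisms such that `hom` is equivariant (for conjugation on `G`) and the Peiffer identity
holds. -/
structure NormalMap (M : Type v) (G : Type w) [Group M] [Group G] where
  hom : M →* G
  act : G →* MulAut M
  hom_act : ∀ (g : G) (m : M), hom (act g m) = g * hom m * g⁻¹
  peiffer : ∀ m m' : M, act (hom m) m' = m * m' * m⁻¹

section NormalClosure

variable {Γ : Type u} {G : Type v} [Group Γ] [Group G]

/-- The relations of the free normal closure of `φ : Γ → G` on the generators `(g, a) ∈ G × Γ`;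
the generator `(g, a)` stands for the translate by `g` of the image of `a`. -/
inductive NormalClosureRel (φ : Γ →* G) : FreeGroup (G × Γ) → Prop
  | mul (g : G) (a b : Γ) : NormalClosureRel φ
      (FreeGroup.of (g, a) * FreeGroup.of (g, b) * (FreeGroup.of (g, a * b))⁻¹)
  | peiffer (g h : G) (a b : Γ) : NormalClosureRel φ
      (FreeGroup.of (g, a) * FreeGroup.of (h, b) * (FreeGroup.of (g, a))⁻¹ *
        (FreeGroup.of (g * φ a * g⁻¹ * h, b))⁻¹)

/-- The free normal closure of `φ : Γ → G`. See `NormalClosure.existsUnique_lift` for its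
universal property. -/
abbrev NormalClosure (φ : Γ →* G) : Type (max u v) :=
  PresentedGroup {r | NormalClosureRel φ r}

namespace NormalClosure

variable (φ : Γ →* G)

/-- The generator `(g, a)` of the free normal closure. -/
def gen (g : G) (a : Γ) : NormalClosure φ := PresentedGroup.of (g, a)

theorem gen_mul (g : G) (a b : Γ) : gen φ g (a * b) = gen φ g a * gen φ g b := by
  have h := PresentedGroup.one_of_mem (rels := {r | NormalClosureRel φ r})
    (NormalClosureRel.mul g a b)
  rw [map_mul, map_mul, map_inv, mul_inv_eq_one] at h
  exact h.symm

theorem gen_conj (g h : G) (a b : Γ) :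
    gen φ g a * gen φ h b * (gen φ g a)⁻¹ = gen φ (g * φ a * g⁻¹ * h) b := by
  have h := PresentedGroup.one_of_mem (rels := {r | NormalClosureRel φ r})
    (NormalClosureRel.peiffer g h a b)
  rw [map_mul, map_mul, map_mul, map_inv, map_inv, mul_inv_eq_one] at h
  exact h

variable {φ} in
/-- Homomorphisms out of the free normal closure. -/
def toGroup {M : Type w} [Group M] (f : G → Γ → M)
    (h₁ : ∀ g a b, f g (a * b) = f g a * f g b)
    (h₂ : ∀ g h a b, f g a * f h b * (f g a)⁻¹ = f (g * φ a * g⁻¹ * h) b) :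
    NormalClosure φ →* M :=
  PresentedGroup.toGroup (f := fun x : G × Γ => f x.1 x.2) (by
    rintro _ (⟨g, a, b⟩ | ⟨g, h, a, b⟩)
    · simp [h₁]
    · simp [← h₂])

variable {φ} in
theorem toGroup_gen {M : Type w} [Group M] (f : G → Γ → M) (h₁ h₂) (g : G) (a : Γ) :
    toGroup (φ := φ) f h₁ h₂ (gen φ g a) = f g a :=
  PresentedGroup.toGroup.of _

variable {φ} in
theorem hom_ext {M : Type w} [Group M] {α β : NormalClosure φ →* M}
    (h : ∀ g a, α (gen φ g a) = β (gen φ g a)) : α = β :=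
  PresentedGroup.ext fun x => h x.1 x.2

/-- The canonical map `Γ → Γ^φ`. -/
def unit : Γ →* NormalClosure φ := MonoidHom.mk' (gen φ 1) (gen_mul φ 1)

/-- The canonical map `Γ^φ → G`, `(g, a) ↦ g φ(a) g⁻¹`. -/
def counit : NormalClosure φ →* G :=
  toGroup (fun g a => g * φ a * g⁻¹) (fun g a b => by rw [map_mul]; group)
    (fun g h a b => by group)

theorem counit_gen (g : G) (a : Γ) : counit φ (gen φ g a) = g * φ a * g⁻¹ :=
  toGroup_gen _ _ _ _ _

theorem counit_unit (a : Γ) : counit φ (unit φ a) = φ a :=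
  (counit_gen φ 1 a).trans (by simp)

/-- Translation by `h`, `(g, a) ↦ (h g, a)`. -/
def translate (h : G) : NormalClosure φ →* NormalClosure φ :=
  toGroup (fun g a => gen φ (h * g) a) (fun _ _ _ => gen_mul φ _ _ _)
    (fun g k a b => by rw [gen_conj]; congr 1; group)

theorem translate_gen (h g : G) (a : Γ) : translate φ h (gen φ g a) = gen φ (h * g) a :=
  toGroup_gen _ _ _ _ _

theorem translate_one : translate φ 1 = MonoidHom.id _ :=
  hom_ext fun g a => by simp [translate_gen]

theorem translate_comp (h k : G) :
    (translate φ h).comp (translate φ k) = translate φ (h * k) :=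
  hom_ext fun g a => by simp [translate_gen, mul_assoc]

/-- The action of `G` on the free normal closure. -/
def act : G →* MulAut (NormalClosure φ) :=
  MonoidHom.mk' (fun h => (translate φ h).toMulEquiv (translate φ h⁻¹)
      (by rw [translate_comp, inv_mul_cancel, translate_one])
      (by rw [translate_comp, mul_inv_cancel, translate_one]))
    (fun h k => by
      ext x
      exact (DFunLike.congr_fun (translate_comp φ h k) x).symm)

theorem act_gen (h g : G) (a : Γ) : act φ h (gen φ g a) = gen φ (h * g) a :=
  translate_gen φ h g a

theorem peiffer_aux (m : NormalClosure φ) : (act φ (counit φ m)).toMonoidHom =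
    (MulAut.conj m).toMonoidHom := by
  have key : (act φ).comp (counit φ) = MulAut.conj := by
    refine hom_ext fun g a => ?_
    have : (act φ (counit φ (gen φ g a))).toMonoidHom =
        (MulAut.conj (gen φ g a)).toMonoidHom := by
      refine hom_ext fun h b => ?_
      change act φ _ (gen φ h b) = gen φ g a * gen φ h b * (gen φ g a)⁻¹
      rw [act_gen, gen_conj, counit_gen]
    exact MulEquiv.ext fun x => DFunLike.congr_fun this x
  exact congrArg MulEquiv.toMonoidHom (DFunLike.congr_fun key m)

/-- The free normal closure as a normal map `Γ^φ → G`. -/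
def normalMap : NormalMap (NormalClosure φ) G where
  hom := counit φ
  act := act φ
  hom_act g m := by
    have : (counit φ).comp (act φ g).toMonoidHom =
        (MulAut.conj g).toMonoidHom.comp (counit φ) := by
      refine hom_ext fun h a => ?_
      change counit φ (act φ g (gen φ h a)) = g * counit φ (gen φ h a) * g⁻¹
      rw [act_gen, counit_gen, counit_gen]; group
    exact DFunLike.congr_fun this m
  peiffer m m' := DFunLike.congr_fun (peiffer_aux φ m) m'

/-- The universal property: `Γ → Γ^φ → G` is initial among the factorizations of `φ` as a
homomorphism `ψ : Γ → M` followed by a normal map `n : M → G`; morphisms are the homomorphisms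
over `G` that respect the actions of `G`. -/
theorem existsUnique_lift {M : Type w} [Group M] (n : NormalMap M G) (ψ : Γ →* M)
    (hψ : ∀ a, n.hom (ψ a) = φ a) :
    ∃! θ : NormalClosure φ →* M, (∀ a, θ (unit φ a) = ψ a) ∧
      (∀ x, n.hom (θ x) = (normalMap φ).hom x) ∧
      ∀ g x, θ ((normalMap φ).act g x) = n.act g (θ x) := by
  let θ : NormalClosure φ →* M := toGroup (fun g a => n.act g (ψ a))
    (fun g a b => by simp) (fun g h a b => by
      rw [← n.peiffer, n.hom_act, hψ, ← MulAut.mul_apply, ← map_mul])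
  have hθ : ∀ g a, θ (gen φ g a) = n.act g (ψ a) := toGroup_gen _ _ _
  refine ⟨θ, ⟨fun a => (hθ 1 a).trans (by simp), fun x => ?_, fun g x => ?_⟩, ?_⟩
  · have : n.hom.comp θ = counit φ := hom_ext fun g a => by
      rw [MonoidHom.comp_apply, hθ, n.hom_act, hψ, counit_gen]
    exact DFunLike.congr_fun this x
  · have : θ.comp (act φ g).toMonoidHom = (n.act g).toMonoidHom.comp θ := by
      refine hom_ext fun h a => ?_
      change θ (act φ g (gen φ h a)) = n.act g (θ (gen φ h a))
      rw [act_gen, hθ, hθ, map_mul, MulAut.mul_apply]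
    exact DFunLike.congr_fun this x
  · rintro θ' ⟨h₁, -, h₃⟩
    refine hom_ext fun g a => ?_
    have h := h₃ g (unit φ a)
    rw [h₁] at h
    rw [hθ, ← h]
    change _ = θ' (act φ g (gen φ 1 a))
    rw [act_gen, mul_one]

end NormalClosure

end NormalClosure

/-- A group together with a homomorphism from `Γ`. -/
structure GroupUnder (Γ : Type u) [Group Γ] : Type (u + 1) where
  carrier : Type u
  [group : Group carrier]
  hom : Γ →* carrier

attribute [instance] GroupUnder.group

section Tower

variable {Γ G : Type u} [Group Γ] [Group G]

/-- The normal closures tower of `φ`, indexed from `0`: `stage φ i` is the group `Γ_{i+1,φ}`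
together with `φ_{i+1} : Γ → Γ_{i+1,φ}`. -/
def stage (φ : Γ →* G) : ℕ → GroupUnder Γ
  | 0 => ⟨G, φ⟩
  | i + 1 => ⟨NormalClosure (stage φ i).hom, NormalClosure.unit (stage φ i).hom⟩

/-- The group `Γ_{i+1,φ}`. -/
abbrev Tower (φ : Γ →* G) (i : ℕ) : Type u := (stage φ i).carrier

/-- The map `φ_{i+1} : Γ → Γ_{i+1,φ}`. -/
abbrev towerMap (φ : Γ →* G) (i : ℕ) : Γ →* Tower φ i := (stage φ i).hom

/-- The structure map from each group of the tower to the preceding one. -/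
def step (φ : Γ →* G) (i : ℕ) : Tower φ (i + 1) →* Tower φ i :=
  NormalClosure.counit (towerMap φ i)

/-- The tower is constant from index `t` on: its structure maps are isomorphisms from there on. -/
def TerminatesAt (φ : Γ →* G) (t : ℕ) : Prop :=
  ∀ i, t ≤ i → Function.Bijective (step φ i)

/-- The inverse limit `Γ_{∞,φ}` of the normal closures tower. -/
def limit (φ : Γ →* G) : Subgroup ((i : ℕ) → Tower φ i) where
  carrier := {x | ∀ i, step φ i (x (i + 1)) = x i}
  mul_mem' {x y} hx hy i := by simp [hx i, hy i]
  one_mem' i := by simp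
  inv_mem' {x} hx i := by simp [hx i]

/-- The projection of the inverse limit to a member of the tower. -/
def proj (φ : Γ →* G) (i : ℕ) : limit φ →* Tower φ i :=
  (Pi.evalMonoidHom (Tower φ) i).comp (limit φ).subtype

/-- The map `Γ_{∞,φ} → G`. -/
def toBase (φ : Γ →* G) : limit φ →* G := proj φ 0

/-- The map `φ_∞ : Γ → Γ_{∞,φ}`. -/
def toLimit (φ : Γ →* G) : Γ →* limit φ :=
  (MonoidHom.mk' (fun a i => towerMap φ i a) (fun a b => by ext i; simp)).codRestrict (limit φ)
    (fun a i => NormalClosure.counit_unit (towerMap φ i) a)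

end Tower

section Series

variable {Γ : Type u} {G : Type v} [Group Γ] [Group G]

/-- The series of successive normal closures of `H` in `G`: `C₀ = G`, `C_{i+1} = ⟨H^{C_i}⟩`. -/
def closureSeries (H : Subgroup G) : ℕ → Subgroup G
  | 0 => ⊤
  | i + 1 => Subgroup.closure {x | ∃ c ∈ closureSeries H i, ∃ h ∈ H, x = c * h * c⁻¹}

/-- The intersection of the series of successive normal closures of `φ(Γ)` in `G`; it is the
terminal member of the series whenever the series terminates. -/
def subnormalClosure (φ : Γ →* G) : Subgroup G := ⨅ i, closureSeries φ.range i

theorem mem_subnormalClosure (φ : Γ →* G) (a : Γ) : φ a ∈ subnormalClosure φ := by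
  refine Subgroup.mem_iInf.2 fun i => ?_
  cases i with
  | zero => exact Subgroup.mem_top _
  | succ i =>
    exact Subgroup.subset_closure ⟨1, one_mem _, φ a, ⟨a, rfl⟩, by simp⟩

/-- The series of successive commutators of `K = ker φ` with `Γ`, indexed from `0`:
`kerSeries φ i` is `K_{i+1}`, where `K₁ = K` and `K_{i+1} = [Γ, K_i]`. -/
def kerSeries (φ : Γ →* G) : ℕ → Subgroup Γ
  | 0 => φ.ker
  | i + 1 => ⁅(⊤ : Subgroup Γ), kerSeries φ i⁆

theorem kerSeries_normal (φ : Γ →* G) (i : ℕ) : (kerSeries φ i).Normal := by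
  induction i with
  | zero => exact MonoidHom.normal_ker φ
  | succ i ih => exact Subgroup.commutator_normal _ _

/-- The intersection of the series of successive commutators of `ker φ` with `Γ`; it is the
terminal member of the series whenever the series terminates. -/
def kerTerminal (φ : Γ →* G) : Subgroup Γ := ⨅ i, kerSeries φ i

instance kerTerminal_normal (φ : Γ →* G) : (kerTerminal φ).Normal :=
  Subgroup.normal_iInf_normal (kerSeries_normal φ)

/-- The map `Γ → 𝒞` induced by `φ`. -/
def inducedRho (φ : Γ →* G) : Γ →* subnormalClosure φ :=
  φ.codRestrict _ (mem_subnormalClosure φ)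

/-- The map `Γ/𝒦 → 𝒞` induced by `φ`. -/
def inducedPsi (φ : Γ →* G) : Γ ⧸ kerTerminal φ →* subnormalClosure φ :=
  QuotientGroup.lift (kerTerminal φ) (inducedRho φ) (fun a ha => by
    have h : a ∈ φ.ker := Subgroup.mem_iInf.1 ha 0
    exact Subtype.ext h)

end Series

/-- `g(1) = 1`, and `g(t) = t ^ ((log_p t + 1) / 2)` for `t ≥ 2` with least prime divisor `p`. -/
def sizeBound (t : ℕ) : ℝ :=
  if t ≤ 1 then 1 else (t : ℝ) ^ ((Real.logb (t.minFac : ℝ) (t : ℝ) + 1) / 2)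

end SubnormalTower

end

/-!
Each `Γ_{i+1} → Γ_i` has central kernel, so once `φ(Γ)` normally generates `G` every `M = Γ_i` is a
central extension of `G` by at most `i` steps which is normally generated by the image of `Γ`. Such
an `M` has order at most `|Γ| g(|G|)`: the quotient of `M` by its nilpotent residual `R` is a
quotient of `Γ`, because a normally generating subset of a nilpotent group generates it, and for
each prime `q` the order of the `q`-part of the intersection of `R` with the kernel of `M → G` is
bounded by a Schur-multiplier estimate in terms of the `q`-part of `|G|`. Hence the orders are
bounded and the tower becomes constant.

A general `φ` is reduced to this case. The image of `Γ_k` in `G` lies in the `k`-th iterated normal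
closure of `φ(Γ)`, so some `Γ_k` maps to `𝒞` and the towers over `G` and over `𝒞` are interleaved.
Dually, `ker (Γ → Γ_{i+1})` contains `[Γ, ker (Γ → Γ_i)]` since `ker (Γ_{i+1} → Γ_i)` is central, so
`𝒦` dies everywhere in the tower.
-/

noncomputable section

namespace SubnormalTower

section CoprimeCommutation

open Subgroup
open scoped commutatorElement

variable {M : Type*} [Group M] {w x : M}

theorem orderOf_commutatorElement_dvd_right (h : ⁅w, x⁆ ∈ center M) :
    orderOf ⁅w, x⁆ ∣ orderOf x := by
  have hconj : (⁅w, x⁆ * x) ^ orderOf x = 1 := by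
    rw [commutatorElement_def, inv_mul_cancel_right, conj_pow, pow_orderOf_eq_one, mul_one,
      mul_inv_cancel]
  have hcomm : Commute ⁅w, x⁆ x := (mem_center_iff.1 h x).symm
  rw [hcomm.mul_pow, pow_orderOf_eq_one, mul_one] at hconj
  exact orderOf_dvd_of_pow_eq_one hconj

theorem orderOf_commutatorElement_dvd_left (h : ⁅w, x⁆ ∈ center M) :
    orderOf ⁅w, x⁆ ∣ orderOf w := by
  rw [← orderOf_inv, commutatorElement_inv]
  exact orderOf_commutatorElement_dvd_right (commutatorElement_inv w x ▸ inv_mem h)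

theorem commute_of_commutatorElement_mem_center (h : ⁅w, x⁆ ∈ center M)
    (hwx : (orderOf w).Coprime (orderOf x)) : Commute w x := by
  rw [← commutatorElement_eq_one_iff_commute, ← orderOf_eq_one_iff]
  exact Nat.eq_one_of_dvd_coprimes hwx (orderOf_commutatorElement_dvd_left h)
    (orderOf_commutatorElement_dvd_right h)

theorem commute_of_mem_upperCentralSeries {n : ℕ} (hw : w ∈ Subgroup.upperCentralSeries M n)
    (hwx : (orderOf w).Coprime (orderOf x)) : Commute w x := by
  induction n generalizing M with
  | zero => exact (mem_bot.1 hw) ▸ Commute.one_left x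
  | succ n ih =>
    rw [← Subgroup.comap_upperCentralSeries_quotient_center] at hw
    let π := QuotientGroup.mk' (center M)
    have hπ : Commute (π w) (π x) :=
      ih hw (hwx.of_dvd (orderOf_map_dvd π w) (orderOf_map_dvd π x))
    rw [← commutatorElement_eq_one_iff_commute, ← map_commutatorElement, ← MonoidHom.mem_ker,
      QuotientGroup.ker_mk'] at hπ
    exact commute_of_commutatorElement_mem_center hπ hwx

theorem comap_upperCentralSeries_le {N : Type*} [Group N] (f : M →* N) {k : ℕ}
    (hf : f.ker ≤ Subgroup.upperCentralSeries M k) (n : ℕ) :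
    (Subgroup.upperCentralSeries N n).comap f ≤ Subgroup.upperCentralSeries M (k + n) := by
  induction n with
  | zero => exact hf
  | succ n ih =>
    intro x hx
    refine Subgroup.mem_upperCentralSeries_succ_iff.2 fun y => ih ?_
    rw [mem_comap, map_commutatorElement]
    exact Subgroup.mem_upperCentralSeries_succ_iff.1 hx (f y)

end CoprimeCommutation

section CentralIndex

open Subgroup hiding commutator
open scoped commutatorElement

variable {S : Type*} [Group S]

/-- The homomorphism `s ↦ ⁅s, x⁆` defined by an element `x` of the second center. -/
def commutatorHom (x : S) (hx : ∀ s : S, ⁅s, x⁆ ∈ center S) : S →* S :=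
  MonoidHom.mk' (fun s => ⁅s, x⁆) fun a b => by
    have hconj : b * x * b⁻¹ = ⁅b, x⁆ * x := by rw [commutatorElement_def, inv_mul_cancel_right]
    have hb := mem_center_iff.1 (hx b)
    calc ⁅a * b, x⁆ = a * (b * x * b⁻¹) * a⁻¹ * x⁻¹ := by
          rw [commutatorElement_def, mul_inv_rev]; simp only [mul_assoc]
      _ = a * ⁅b, x⁆ * (x * a⁻¹ * x⁻¹) := by rw [hconj]; simp only [mul_assoc]
      _ = ⁅b, x⁆ * ⁅a, x⁆ := by rw [hb a, commutatorElement_def a x]; simp only [mul_assoc]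
      _ = ⁅a, x⁆ * ⁅b, x⁆ := (hb _).symm

theorem commutatorHom_apply (x : S) (hx : ∀ s : S, ⁅s, x⁆ ∈ center S) (s : S) :
    commutatorHom x hx s = ⁅s, x⁆ := rfl

theorem center_lt_ker_commutatorHom {x : S} (hx : ∀ s : S, ⁅s, x⁆ ∈ center S) (hxc : x ∉ center S) :
    center S < (commutatorHom x hx).ker := by
  refine lt_of_le_of_ne (fun z hz => ?_) fun h => hxc (h ▸ ?_)
  · rw [MonoidHom.mem_ker, commutatorHom_apply, commutatorElement_eq_one_iff_mul_comm]
    exact (mem_center_iff.1 hz x).symm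
  · rw [MonoidHom.mem_ker, commutatorHom_apply, commutatorElement_self]

theorem normal_of_le_center {A : Subgroup S} (hA : A ≤ center S) : A.Normal :=
  ⟨fun a ha g => by rwa [mem_center_iff.1 (hA ha) g, mul_inv_cancel_right]⟩

theorem mem_comap_center_quotient {B : Subgroup S} [B.Normal] {x : S} :
    x ∈ (center (S ⧸ B)).comap (QuotientGroup.mk' B) ↔ ∀ s : S, ⁅s, x⁆ ∈ B := by
  simp_rw [mem_comap, mem_center_iff, (QuotientGroup.mk'_surjective B).forall,
    ← commutatorElement_eq_one_iff_mul_comm, ← map_commutatorElement, ← MonoidHom.mem_ker,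
    QuotientGroup.ker_mk']

theorem center_lt_comap_center_quotient {B : Subgroup S} [B.Normal] {x : S}
    (hx : ∀ s : S, ⁅s, x⁆ ∈ B) (hxc : x ∉ center S) :
    center S < (center (S ⧸ B)).comap (QuotientGroup.mk' B) := by
  refine lt_of_le_of_ne (fun z hz => mem_comap_center_quotient.2 fun s => ?_)
    fun h => hxc (h ▸ mem_comap_center_quotient.2 hx)
  rw [commutatorElement_eq_one_iff_mul_comm.2 (mem_center_iff.1 hz s)]
  exact one_mem B

theorem exists_notMem_center_commutatorElement_mem_center [Nontrivial (center (S ⧸ center S))] :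
    ∃ x ∉ center S, ∀ s : S, ⁅s, x⁆ ∈ center S := by
  obtain ⟨⟨y, hy⟩, hy1⟩ := exists_ne (1 : center (S ⧸ center S))
  obtain ⟨x, rfl⟩ := QuotientGroup.mk'_surjective (center S) y
  exact ⟨x, fun h => hy1 (Subtype.ext ((QuotientGroup.eq_one_iff x).2 h)),
    mem_comap_center_quotient.1 hy⟩

theorem card_commutator_eq_mul (B : Subgroup S) [B.Normal] (hB : B ≤ commutator S) :
    Nat.card (commutator S) = Nat.card B * Nat.card (commutator (S ⧸ B)) := by
  have hmap : (commutator S).map (QuotientGroup.mk' B) = commutator (S ⧸ B) := by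
    rw [_root_.commutator_def, _root_.commutator_def, map_commutator, ← MonoidHom.range_eq_map,
      QuotientGroup.range_mk']
  rw [← hmap, ← relIndex_bot_left, ← relIndex_bot_left, ← relIndex_ker, QuotientGroup.ker_mk',
    relIndex_mul_relIndex _ _ _ bot_le hB]

theorem index_dvd_pow_of_lt {p n : ℕ} (hp : p.Prime) {A E : Subgroup S} (hAE : A < E)
    (hA : A.index ∣ p ^ (n + 1)) : E.index ∣ p ^ n := by
  have hmul : A.relIndex E * E.index ∣ p ^ (n + 1) := by rwa [relIndex_mul_index hAE.le]
  obtain ⟨m, hm, hEm⟩ := (Nat.dvd_prime_pow hp).1 (dvd_of_mul_left_dvd hmul)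
  obtain rfl | hlt := hm.eq_or_lt
  · rw [hEm] at hmul
    have hone : A.relIndex E ∣ 1 :=
      Nat.dvd_of_mul_dvd_mul_right (pow_pos hp.pos (n + 1)) (by rwa [one_mul])
    exact absurd (relIndex_eq_one.1 (Nat.dvd_one.1 hone)) hAE.not_ge
  · exact hEm ▸ pow_dvd_pow p (Nat.lt_succ_iff.1 hlt)

theorem card_commutator_dvd_of_index_center_dvd {p n : ℕ} (hp : p.Prime)
    (hn : (center S).index ∣ p ^ n) : Nat.card (commutator S) ∣ p ^ n.choose 2 := by
  induction n generalizing S with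
  | zero =>
    rw [pow_zero, Nat.dvd_one, index_eq_one, ← commutator_eq_bot_iff_center_eq_top] at hn
    rw [hn, card_bot]
    exact one_dvd _
  | succ n ih =>
    by_cases htop : center S = ⊤
    · rw [(commutator_eq_bot_iff_center_eq_top S).2 htop, card_bot]
      exact one_dvd _
    have : Fact p.Prime := ⟨hp⟩
    have hquot : IsPGroup p (S ⧸ center S) := by
      obtain ⟨m, -, hm⟩ := (Nat.dvd_prime_pow hp).1 hn
      exact IsPGroup.of_card (n := m) hm
    have : Finite (S ⧸ center S) :=
      Nat.finite_of_card_ne_zero (ne_zero_of_dvd_ne_zero (pow_ne_zero _ hp.ne_zero) hn)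
    have : Nontrivial (S ⧸ center S) := QuotientGroup.nontrivial_iff.2 htop
    have := hquot.center_nontrivial
    obtain ⟨x, hxc, hx⟩ := exists_notMem_center_commutatorElement_mem_center (S := S)
    let B := (commutatorHom x hx).range
    have : B.Normal := normal_of_le_center (by rintro _ ⟨s, rfl⟩; exact hx s)
    have hBle : B ≤ commutator S := by
      rintro _ ⟨s, rfl⟩
      exact commutator_mem_commutator (mem_top s) (mem_top x)
    have hB : Nat.card B ∣ p ^ n := by
      rw [← index_ker]
      exact index_dvd_pow_of_lt hp (center_lt_ker_commutatorHom hx hxc) hn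
    have hSB : (center (S ⧸ B)).index ∣ p ^ n := by
      rw [← index_comap_of_surjective _ (QuotientGroup.mk'_surjective B)]
      exact index_dvd_pow_of_lt hp (center_lt_comap_center_quotient (fun s => ⟨s, rfl⟩) hxc) hn
    rw [card_commutator_eq_mul B hBle, Nat.choose_succ_succ' n 1, Nat.choose_one_right, pow_add]
    exact mul_dvd_mul hB (ih hSB)

end CentralIndex

section PrimeResidual

open Subgroup hiding commutator

variable {M : Type*} [Group M] {q : ℕ}

/-- The subgroup `O^q(M)` generated by the elements of order prime to `q`, for a prime `q` and a
finite group `M`. -/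
def primeResidual (q : ℕ) (M : Type*) [Group M] : Subgroup M :=
  closure {x | (orderOf x).Coprime q}

instance primeResidual_characteristic : (primeResidual q M).Characteristic := by
  refine characteristic_iff_map_le.2 fun e => ?_
  rw [primeResidual, MonoidHom.map_closure, closure_le]
  rintro _ ⟨x, hx, rfl⟩
  exact subset_closure ((e.orderOf_eq x).symm ▸ hx : (orderOf (e x)).Coprime q)

theorem primeResidual_primeResidual : primeResidual q (primeResidual q M) = ⊤ := by
  have hpreimage : {x : primeResidual q M | (orderOf x).Coprime q} =
      (↑) ⁻¹' {x : M | (orderOf x).Coprime q} := by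
    ext x
    simp
  exact (congrArg Subgroup.closure hpreimage).trans closure_closure_coe_preimage

theorem isPGroup_quotient_primeResidual [Fact q.Prime] [Finite M] :
    IsPGroup q (M ⧸ primeResidual q M) := by
  rw [IsPGroup, QuotientGroup.mk_surjective.forall]
  refine fun g => ⟨(orderOf g).factorization q, ?_⟩
  rw [← QuotientGroup.mk_pow, QuotientGroup.eq_one_iff]
  refine subset_closure (?_ : (orderOf _).Coprime q)
  rw [orderOf_pow_of_dvd (pow_ne_zero _ (Fact.out : q.Prime).ne_zero) (Nat.ordProj_dvd _ _)]
  exact (Nat.coprime_ordCompl Fact.out (orderOf_pos g).ne').symm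

theorem eq_one_of_primeResidual_eq_top (hM : primeResidual q M = ⊤) {N : Type*} [Group N]
    (hN : IsPGroup q N) (f : M →* N) : f = 1 := by
  refine MonoidHom.eq_of_eqOn_dense hM fun x hx => orderOf_eq_one_iff.1 ?_
  obtain ⟨k, hk⟩ := hN (f x)
  exact Nat.eq_one_of_dvd_coprimes (Nat.Coprime.pow_right k hx) (orderOf_map_dvd f x)
    (orderOf_dvd_of_pow_eq_one hk)

/- The transfer `M → P/[P, P]` is trivial, and it sends a central element `w` of `M` to the class of
`w ^ [M : P]`. -/
theorem center_subgroupOf_le_commutator [Fact q.Prime] [Finite M] (hM : primeResidual q M = ⊤)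
    (P : Sylow q M) : (center M).subgroupOf P ≤ commutator P := by
  intro w hw
  have hab : IsPGroup q (Abelianization P) :=
    P.2.of_surjective Abelianization.of QuotientGroup.mk_surjective
  have htransfer : MonoidHom.transfer Abelianization.of (w : M) = 1 :=
    DFunLike.congr_fun (eq_one_of_primeResidual_eq_top hM hab _) _
  have hpow : Abelianization.of w ^ (P : Subgroup M).index = 1 := by
    rw [← map_pow, ← htransfer]
    exact (MonoidHom.transfer_eq_pow _ _ fun k g _ => by
      rw [mem_center_iff.1 (pow_mem (mem_subgroupOf.1 hw) k) g⁻¹, inv_mul_cancel_right]).symm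
  rw [← Abelianization.ker_of, MonoidHom.mem_ker]
  exact (hab.powEquiv' P.not_dvd_index).injective (hpow.trans (one_pow _).symm)

theorem inf_upperCentralSeries_le_center (hM : primeResidual q M = ⊤) {P : Subgroup M}
    (hP : IsPGroup q P) (n : ℕ) : P ⊓ Subgroup.upperCentralSeries M n ≤ center M := by
  rintro w ⟨hwP, hw⟩
  obtain ⟨k, hk⟩ := hP ⟨w, hwP⟩
  have hdvd : orderOf w ∣ q ^ k := orderOf_dvd_of_pow_eq_one (congrArg Subtype.val hk)
  have hle : primeResidual q M ≤ centralizer {w} := (closure_le _).2 fun x hx =>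
    mem_centralizer_singleton_iff.2 (commute_of_mem_upperCentralSeries hw
      ((Nat.Coprime.pow_right k hx).symm.coprime_dvd_left hdvd)).eq.symm
  rw [hM] at hle
  exact mem_center_iff.2 fun x => mem_centralizer_singleton_iff.1 (hle (mem_top x))

theorem factorization_card_le_of_primeResidual_eq_top [Fact q.Prime] [Finite M]
    (hM : primeResidual q M = ⊤) {Z : Subgroup M} [Z.Normal] {n : ℕ}
    (hZ : Z ≤ Subgroup.upperCentralSeries M n) :
    (Nat.card Z).factorization q ≤ (Z.index.factorization q).choose 2 := by
  have hq : q.Prime := Fact.out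
  obtain ⟨P⟩ := (inferInstance : Nonempty (Sylow q M))
  let A := Z.subgroupOf (P : Subgroup M)
  have hAcenter : A ≤ (center M).subgroupOf P := fun w hw =>
    inf_upperCentralSeries_le_center hM P.2 n ⟨w.2, hZ hw⟩
  have hAP : A ≤ center P := fun w hw =>
    mem_center_iff.2 fun x => Subtype.ext (mem_center_iff.1 (hAcenter hw) x)
  have hindex : A.index ∣ q ^ Z.index.factorization q := by
    obtain ⟨k, hk⟩ := P.2.index A
    rw [hk]
    refine pow_dvd_pow q ((hq.pow_dvd_iff_le_factorization index_ne_zero_of_finite).1 ?_)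
    exact hk ▸ relIndex_dvd_index_of_normal Z (P : Subgroup M)
  have hcard : q ^ (Nat.card Z).factorization q ∣ Nat.card A := by
    refine Nat.dvd_of_mul_dvd_mul_right (pow_pos hq.pos (Z.index.factorization q)) ?_
    rw [← pow_add, ← Finsupp.add_apply, ← Nat.factorization_mul Nat.card_pos.ne'
      index_ne_zero_of_finite, card_mul_index, ← P.card_eq_multiplicity, ← card_mul_index A]
    exact mul_dvd_mul_left _ hindex
  rw [← Nat.pow_dvd_pow_iff_le_right hq.one_lt]
  calc q ^ (Nat.card Z).factorization q ∣ Nat.card A := hcard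
    _ ∣ Nat.card (commutator P) :=
      card_dvd_of_le (hAcenter.trans (center_subgroupOf_le_commutator hM P))
    _ ∣ q ^ (Z.index.factorization q).choose 2 :=
      card_commutator_dvd_of_index_center_dvd hq ((index_dvd_of_le hAP).trans hindex)

end PrimeResidual

section SizeBound

theorem factorization_le_log_minFac {t : ℕ} (ht : t ≠ 0) (q : ℕ) :
    t.factorization q ≤ Nat.log t.minFac t := by
  rcases eq_or_ne (t.factorization q) 0 with h0 | h0
  · exact h0 ▸ Nat.zero_le _
  have hqt : q ∈ t.primeFactors := Nat.support_factorization t ▸ Finsupp.mem_support_iff.2 h0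
  have hq := Nat.prime_of_mem_primeFactors hqt
  have ht1 : t ≠ 1 := by rintro rfl; simp at hqt
  refine Nat.le_log_of_pow_le (Nat.minFac_prime ht1).one_lt ?_
  calc t.minFac ^ t.factorization q ≤ q ^ t.factorization q :=
        Nat.pow_le_pow_left (Nat.minFac_le_of_dvd hq.two_le (Nat.dvd_of_mem_primeFactors hqt)) _
    _ ≤ t := Nat.ordProj_le q ht

theorem sq_mul_dvd_pow_log_minFac {t y : ℕ} (ht : t ≠ 0) (hy : y ≠ 0)
    (h : ∀ q, q.Prime → y.factorization q ≤ (t.factorization q).choose 2) :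
    (t * y) ^ 2 ∣ t ^ (Nat.log t.minFac t + 1) := by
  rw [← Nat.factorization_prime_le_iff_dvd (pow_ne_zero _ (mul_ne_zero ht hy)) (pow_ne_zero _ ht)]
  intro q hq
  have hlog := factorization_le_log_minFac ht q
  simp only [Nat.factorization_pow, Nat.factorization_mul ht hy, Finsupp.smul_apply,
    Finsupp.add_apply, smul_eq_mul]
  set a := t.factorization q
  calc 2 * (a + y.factorization q) ≤ 2 * (a + a.choose 2) := by gcongr; exact h q hq
    _ = 2 * (a + 1).choose 2 := by rw [Nat.choose_succ_succ' a 1, Nat.choose_one_right]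
    _ ≤ (a + 1) * a := by rw [Nat.choose_two_right]; exact Nat.mul_div_le _ _
    _ ≤ (Nat.log t.minFac t + 1) * a := by gcongr

theorem sizeBound_nonneg (t : ℕ) : 0 ≤ sizeBound t := by
  rw [sizeBound]
  split_ifs <;> positivity

theorem pow_log_minFac_le_sizeBound_sq {t : ℕ} (ht : t ≠ 0) :
    (t : ℝ) ^ (Nat.log t.minFac t + 1) ≤ sizeBound t ^ 2 := by
  rw [sizeBound]
  split_ifs with ht1
  · obtain rfl : t = 1 := by lia
    simp
  · rw [← Real.rpow_natCast, ← Real.rpow_natCast (_ ^ _) 2, ← Real.rpow_mul t.cast_nonneg]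
    refine Real.rpow_le_rpow_of_exponent_le (by exact_mod_cast Nat.one_le_iff_ne_zero.2 ht) ?_
    push_cast
    linarith [Real.natLog_le_logb t t.minFac]

theorem mul_le_sizeBound {t y : ℕ} (ht : t ≠ 0) (hy : y ≠ 0)
    (h : ∀ q, q.Prime → y.factorization q ≤ (t.factorization q).choose 2) :
    (t * y : ℝ) ≤ sizeBound t := by
  refine le_of_sq_le_sq ?_ (sizeBound_nonneg t)
  have hle := Nat.le_of_dvd (by positivity) (sq_mul_dvd_pow_log_minFac ht hy h)
  calc (t * y : ℝ) ^ 2 ≤ (t : ℝ) ^ (Nat.log t.minFac t + 1) := by exact_mod_cast hle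
    _ ≤ sizeBound t ^ 2 := pow_log_minFac_le_sizeBound_sq ht

end SizeBound

theorem exists_forall_ge_eq_iInf {α : Type*} [CompleteLattice α] [WellFoundedLT α] {f : ℕ → α}
    (hf : Antitone f) : ∃ t, ∀ i, t ≤ i → f i = ⨅ j, f j := by
  obtain ⟨t, ht⟩ := WellFoundedLT.antitone_chain_condition hf
  refine ⟨t, fun i hi => le_antisymm (le_iInf fun j => ?_) (iInf_le f i)⟩
  rw [← ht i hi]
  rcases le_total t j with hj | hj
  · exact (ht j hj).le
  · exact hf hj

section NilpotentResidual

open Subgroup hiding commutator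

variable {M : Type*} [Group M]

/-- The intersection of the lower central series of `M`; for finite `M` it is the smallest normal
subgroup with nilpotent quotient. -/
def nilpotentResidual (M : Type*) [Group M] : Subgroup M :=
  ⨅ n, (⊤ : Subgroup M).lowerCentralSeries n

instance nilpotentResidual_normal : (nilpotentResidual M).Normal :=
  normal_iInf_normal fun _ => inferInstance

theorem isNilpotent_quotient_iff {N : Subgroup M} [N.Normal] :
    Group.IsNilpotent (M ⧸ N) ↔ ∃ n, (⊤ : Subgroup M).lowerCentralSeries n ≤ N := by
  have hmap (n : ℕ) : (⊤ : Subgroup (M ⧸ N)).lowerCentralSeries n =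
      ((⊤ : Subgroup M).lowerCentralSeries n).map (QuotientGroup.mk' N) := by
    rw [map_lowerCentralSeries, ← MonoidHom.range_eq_map, QuotientGroup.range_mk']
  simp_rw [Subgroup.nilpotent_iff_lowerCentralSeries, hmap, Subgroup.map_eq_bot_iff,
    QuotientGroup.ker_mk']

instance isNilpotent_quotient_nilpotentResidual [Finite M] :
    Group.IsNilpotent (M ⧸ nilpotentResidual M) := by
  obtain ⟨n, hn⟩ := exists_forall_ge_eq_iInf (Subgroup.lowerCentralSeries_antitone (⊤ : Subgroup M))
  exact isNilpotent_quotient_iff.2 ⟨n, (hn n le_rfl).le⟩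

theorem nilpotentResidual_le (N : Subgroup M) [N.Normal] [hN : Group.IsNilpotent (M ⧸ N)] :
    nilpotentResidual M ≤ N := by
  obtain ⟨n, hn⟩ := isNilpotent_quotient_iff.1 hN
  exact (iInf_le _ n).trans hn

theorem nilpotentResidual_le_primeResidual [Finite M] (q : ℕ) [Fact q.Prime] :
    nilpotentResidual M ≤ primeResidual q M :=
  have := (isPGroup_quotient_primeResidual (q := q) (M := M)).isNilpotent
  nilpotentResidual_le _

theorem normalClosure_range_comp_eq_top {Λ N : Type*} [Group Λ] [Group N] {f : Λ →* M}
    (hf : normalClosure (Set.range f) = ⊤) {π : M →* N} (hπ : Function.Surjective π) :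
    normalClosure (Set.range (π.comp f)) = ⊤ := by
  rw [MonoidHom.coe_comp, Set.range_comp, ← map_normalClosure _ π hπ, hf,
    map_top_of_surjective π hπ]

theorem surjective_of_normalClosure_range_eq_top {Λ : Type*} [Group Λ] [Finite M]
    [Group.IsNilpotent M] {f : Λ →* M} (hf : normalClosure (Set.range f) = ⊤) :
    Function.Surjective f := by
  rw [← MonoidHom.range_eq_top]
  by_contra h
  obtain ⟨K, hK, hle⟩ := (eq_top_or_exists_le_coatom f.range).resolve_left h
  have : K.Normal :=
    NormalizerCondition.normal_of_coatom K Group.normalizerCondition_of_isNilpotent hK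
  exact hK.1 (top_le_iff.1 (hf ▸ normalClosure_le_normal hle))

theorem card_quotient_nilpotentResidual_le [Finite M] {Λ : Type*} [Group Λ] [Finite Λ]
    {f : Λ →* M} (hf : normalClosure (Set.range f) = ⊤) :
    Nat.card (M ⧸ nilpotentResidual M) ≤ Nat.card Λ := by
  let π := QuotientGroup.mk' (nilpotentResidual M)
  have hπ : Function.Surjective π := QuotientGroup.mk'_surjective _
  exact Nat.card_le_card_of_surjective (π.comp f) <|
    surjective_of_normalClosure_range_eq_top (normalClosure_range_comp_eq_top hf hπ)

end NilpotentResidual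

section HypercentralBound

open Subgroup hiding commutator

variable {M : Type*} [Group M] [Finite M] {n : ℕ}

theorem factorization_card_subgroupOf_le {q : ℕ} [Fact q.Prime] {Z : Subgroup M} [Z.Normal]
    (hZ : Z ≤ Subgroup.upperCentralSeries M n) {N : Subgroup M} (hN : N ≤ primeResidual q M) :
    (Nat.card (Z.subgroupOf N)).factorization q ≤ (Z.index.factorization q).choose 2 := by
  let R := primeResidual q M
  have hZR : Z.subgroupOf R ≤ Subgroup.upperCentralSeries R (0 + n) :=
    (comap_mono hZ).trans (comap_upperCentralSeries_le R.subtype (R.ker_subtype.trans_le bot_le) n)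
  have hcard : Nat.card (Z.subgroupOf N) ∣ Nat.card (Z.subgroupOf R) :=
    card_comap_dvd_of_injective (Z.subgroupOf R) (inclusion hN) (inclusion_injective hN)
  calc (Nat.card (Z.subgroupOf N)).factorization q
      ≤ (Nat.card (Z.subgroupOf R)).factorization q :=
        (Nat.factorization_le_iff_dvd Nat.card_pos.ne' Nat.card_pos.ne').2 hcard q
    _ ≤ ((Z.subgroupOf R).index.factorization q).choose 2 :=
        factorization_card_le_of_primeResidual_eq_top primeResidual_primeResidual hZR
    _ ≤ (Z.index.factorization q).choose 2 := Nat.choose_le_choose 2 <|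
        (Nat.factorization_le_iff_dvd index_ne_zero_of_finite index_ne_zero_of_finite).2
          (relIndex_dvd_index_of_normal Z R) q

theorem card_nilpotentResidual_le {Z : Subgroup M} [Z.Normal]
    (hZ : Z ≤ Subgroup.upperCentralSeries M n) :
    (Nat.card (nilpotentResidual M) : ℝ) ≤ sizeBound Z.index := by
  let N := nilpotentResidual M
  have hcard : Nat.card N ≤ Z.index * Nat.card (Z.subgroupOf N) := by
    rw [← card_mul_index (Z.subgroupOf N), mul_comm]
    exact Nat.mul_le_mul_right _ (Nat.le_of_dvd (Nat.pos_of_ne_zero index_ne_zero_of_finite)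
      (relIndex_dvd_index_of_normal Z N))
  calc (Nat.card N : ℝ) ≤ Z.index * Nat.card (Z.subgroupOf N) := by exact_mod_cast hcard
    _ ≤ sizeBound Z.index :=
      mul_le_sizeBound index_ne_zero_of_finite Nat.card_pos.ne' fun q hq =>
        have : Fact q.Prime := ⟨hq⟩
        factorization_card_subgroupOf_le hZ (nilpotentResidual_le_primeResidual q)

theorem card_le_mul_sizeBound {Λ C : Type*} [Group Λ] [Group C] [Finite Λ]
    {f : Λ →* M} (hf : normalClosure (Set.range f) = ⊤) {π : M →* C}
    (hπ : Function.Surjective π) (hker : π.ker ≤ Subgroup.upperCentralSeries M n) :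
    (Nat.card M : ℝ) ≤ Nat.card Λ * sizeBound (Nat.card C) := by
  have hindex : π.ker.index = Nat.card C := by
    rw [index_ker, MonoidHom.range_eq_top.2 hπ, card_top]
  rw [card_eq_card_quotient_mul_card_subgroup (nilpotentResidual M), Nat.cast_mul, ← hindex]
  gcongr
  · exact card_quotient_nilpotentResidual_le hf
  · exact card_nilpotentResidual_le hker

end HypercentralBound

section FiniteCentralIndex

open Subgroup hiding commutator
open scoped commutatorElement

variable {M : Type*} [Group M]

theorem commutatorElement_mul_mul_of_mem_center {z w : M} (hz : z ∈ center M) (hw : w ∈ center M)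
    (x y : M) : ⁅x * z, y * w⁆ = ⁅x, y⁆ := by
  have hz' : ⁅z, y * w⁆ = 1 :=
    commutatorElement_eq_one_iff_mul_comm.2 (mem_center_iff.1 hz (y * w)).symm
  have hw' : ⁅x, w⁆ = 1 := commutatorElement_eq_one_iff_mul_comm.2 (mem_center_iff.1 hw x)
  rw [commutatorElement_mul_left_eq_conj_mul, hz', mul_one, mul_inv_cancel,
    one_mul, commutatorElement_mul_right_eq_mul_conj, hw', mul_one, mul_inv_cancel_right]

theorem finite_commutatorSet [(center M).FiniteIndex] : Finite (commutatorSet M) := by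
  have : Finite (M ⧸ center M) := finite_quotient_of_finiteIndex
  refine Set.Finite.subset
    (Set.finite_range fun p : (M ⧸ center M) × (M ⧸ center M) => ⁅p.1.out, p.2.out⁆) ?_
  rintro _ ⟨x, y, rfl⟩
  obtain ⟨z, hz⟩ := QuotientGroup.mk_out_eq_mul (center M) x
  obtain ⟨w, hw⟩ := QuotientGroup.mk_out_eq_mul (center M) y
  refine ⟨(x, y), ?_⟩
  dsimp only
  rw [hz, hw, commutatorElement_mul_mul_of_mem_center z.2 w.2]

theorem finite_of_normalClosure_range_eq_top [(center M).FiniteIndex] {Λ : Type*} [Group Λ]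
    [Finite Λ] {f : Λ →* M} (hf : normalClosure (Set.range f) = ⊤) : Finite M := by
  have := finite_commutatorSet (M := M)
  have hab := normalClosure_range_comp_eq_top hf (π := Abelianization.of)
    QuotientGroup.mk_surjective
  rw [← MonoidHom.coe_range, normalClosure_eq_self, MonoidHom.range_eq_top] at hab
  have : Finite (M ⧸ commutator M) := Finite.of_surjective _ hab
  exact Finite.of_subgroup_quotient (commutator M)

end FiniteCentralIndex

namespace NormalClosure

open Subgroup (center normalClosure)

variable {Γ : Type u} {G : Type v} [Group Γ] [Group G] (φ : Γ →* G)

theorem eq_top_of_gen_mem {S : Subgroup (NormalClosure φ)} (h : ∀ g a, gen φ g a ∈ S) : S = ⊤ :=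
  top_le_iff.1 fun x _ => PresentedGroup.generated_by _ _ (fun ⟨g, a⟩ => h g a) x

theorem act_unit (g : G) (a : Γ) : act φ g (unit φ a) = gen φ g a :=
  (act_gen φ g 1 a).trans (by rw [mul_one])

theorem act_counit (x y : NormalClosure φ) : act φ (counit φ x) y = x * y * x⁻¹ :=
  (normalMap φ).peiffer x y

theorem gen_counit (x : NormalClosure φ) (a : Γ) :
    gen φ (counit φ x) a = x * unit φ a * x⁻¹ := by
  rw [← act_unit, act_counit]

theorem ker_counit_le_center : (counit φ).ker ≤ center (NormalClosure φ) := by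
  refine fun x hx => Subgroup.mem_center_iff.2 fun y => ?_
  have hact := act_counit φ x y
  rw [MonoidHom.mem_ker.1 hx, map_one, MulAut.one_apply] at hact
  exact eq_mul_inv_iff_mul_eq.1 hact

variable {φ}

theorem counit_surjective (hφ : normalClosure (Set.range φ) = ⊤) :
    Function.Surjective (counit φ) := by
  rw [← MonoidHom.range_eq_top, ← top_le_iff, ← hφ]
  have : (counit φ).range.Normal := ⟨by
    rintro _ ⟨x, rfl⟩ g
    exact ⟨act φ g x, (normalMap φ).hom_act g x⟩⟩
  refine Subgroup.normalClosure_le_normal ?_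
  rintro _ ⟨a, rfl⟩
  exact ⟨unit φ a, counit_unit φ a⟩

theorem normalClosure_range_unit (h : Function.Surjective (counit φ)) :
    normalClosure (Set.range (unit φ)) = ⊤ := by
  refine eq_top_of_gen_mem φ fun g a => ?_
  obtain ⟨y, rfl⟩ := h g
  rw [gen_counit]
  exact Subgroup.normalClosure_normal.conj_mem _
    (Subgroup.subset_normalClosure (Set.mem_range_self a)) y

theorem finite_of_counit_surjective [Finite Γ] [Finite G] (h : Function.Surjective (counit φ)) :
    Finite (NormalClosure φ) :=
  have := Subgroup.finiteIndex_of_le (ker_counit_le_center φ)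
  finite_of_normalClosure_range_eq_top (normalClosure_range_unit h)

theorem commutator_le_ker_unit {K : Subgroup Γ} (hK : K ≤ φ.ker) :
    ⁅(⊤ : Subgroup Γ), K⁆ ≤ (unit φ).ker := by
  refine Subgroup.commutator_le.2 fun a _ b hb => ?_
  have hcentral : unit φ b ∈ center (NormalClosure φ) := ker_counit_le_center φ <| by
    rw [MonoidHom.mem_ker, counit_unit]
    exact hK hb
  rw [MonoidHom.mem_ker, map_commutatorElement, commutatorElement_eq_one_iff_mul_comm]
  exact Subgroup.mem_center_iff.1 hcentral _

section Map

variable {Λ H : Type*} [Group Λ] [Group H] {ψ : Λ →* H}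

/-- The homomorphism of free normal closures induced by a commutative square from `φ` to `ψ`. -/
def map (p : Γ →* Λ) (f : G →* H) (hf : ∀ a, f (φ a) = ψ (p a)) :
    NormalClosure φ →* NormalClosure ψ :=
  toGroup (fun g a => gen ψ (f g) (p a)) (fun g a b => by rw [map_mul, gen_mul])
    (fun g h a b => by simp only [gen_conj, map_mul, map_inv, hf])

variable {p : Γ →* Λ} {f : G →* H} (hf : ∀ a, f (φ a) = ψ (p a))

theorem map_gen (g : G) (a : Γ) : map p f hf (gen φ g a) = gen ψ (f g) (p a) :=
  toGroup_gen _ _ _ _ _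

theorem map_unit (a : Γ) : map p f hf (unit φ a) = unit ψ (p a) :=
  (map_gen hf 1 a).trans (by rw [map_one]; rfl)

theorem counit_map (x : NormalClosure φ) : counit ψ (map p f hf x) = f (counit φ x) := by
  have : (counit ψ).comp (map p f hf) = f.comp (counit φ) := hom_ext fun g a => by
    simp only [MonoidHom.comp_apply, map_gen, counit_gen, map_mul, map_inv, hf]
  exact DFunLike.congr_fun this x

theorem map_map_of_eq {Ξ L : Type*} [Group Ξ] [Group L] {χ : Ξ →* L} {q : Λ →* Ξ} {g : H →* L}
    (hg : ∀ b, g (ψ b) = χ (q b)) {r : Γ →* Ξ} {k : G →* L} (hk : ∀ a, k (φ a) = χ (r a))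
    (hr : ∀ a, q (p a) = r a) (hgf : ∀ x, g (f x) = k x) (x : NormalClosure φ) :
    map q g hg (map p f hf x) = map r k hk x := by
  have : (map q g hg).comp (map p f hf) = map r k hk := hom_ext fun x a => by
    simp only [MonoidHom.comp_apply, map_gen, hgf, hr]
  exact DFunLike.congr_fun this x

theorem map_bijective (hp : Function.Surjective p) (hker : p.ker ≤ (unit φ).ker)
    (hbij : Function.Bijective f) : Function.Bijective (map p f hf) := by
  let e := MulEquiv.ofBijective f hbij
  have hgen {a b : Γ} (hab : p a = p b) (g : G) : gen φ g a = gen φ g b := by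
    have hunit : unit φ a = unit φ b := by
      rw [MonoidHom.eq_iff] at hab ⊢
      exact hker hab
    rw [← act_unit, hunit, act_unit]
  have hs := Function.surjInv_eq hp
  have hinv (l : Λ) : e.symm (ψ l) = φ (Function.surjInv hp l) :=
    (MulEquiv.symm_apply_eq e).2 (by rw [MulEquiv.ofBijective_apply, hf, hs])
  let inv : NormalClosure ψ →* NormalClosure φ :=
    toGroup (fun h l => gen φ (e.symm h) (Function.surjInv hp l))
      (fun h l m => by rw [← gen_mul]; exact hgen (by rw [hs, map_mul, hs, hs]) _)
      (fun g h l m => by rw [gen_conj, map_mul, map_mul, map_mul, map_inv, hinv])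
  have hleft : inv.comp (map p f hf) = MonoidHom.id _ := hom_ext fun g a => by
    rw [MonoidHom.comp_apply, map_gen, toGroup_gen, hgen (hs (p a)), MonoidHom.id_apply]
    exact congrArg (gen φ · a) (e.symm_apply_apply g)
  have hright : (map p f hf).comp inv = MonoidHom.id _ := hom_ext fun h l => by
    rw [MonoidHom.comp_apply, toGroup_gen, map_gen, hs, MonoidHom.id_apply]
    exact congrArg (gen ψ · l) (e.apply_symm_apply h)
  exact Function.bijective_iff_has_inverse.2
    ⟨inv, DFunLike.congr_fun hleft, DFunLike.congr_fun hright⟩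

end Map

theorem map_id_apply_of_eq_self {f : G →* G} (hφ : ∀ a, f (φ a) = φ (MonoidHom.id Γ a))
    (hf : ∀ g, f g = g) (x : NormalClosure φ) : map (MonoidHom.id Γ) f hφ x = x := by
  have : map (MonoidHom.id Γ) f hφ = MonoidHom.id _ := hom_ext fun g a => by
    rw [map_gen, hf, MonoidHom.id_apply, MonoidHom.id_apply]
  exact DFunLike.congr_fun this x

theorem counit_unit_eq_map (x : NormalClosure (unit φ)) :
    counit (unit φ) x = map (MonoidHom.id Γ) (counit φ) (counit_unit φ) x := by
  have : counit (unit φ) = map (MonoidHom.id Γ) (counit φ) (counit_unit φ) :=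
    hom_ext fun g a => by rw [counit_gen, map_gen, gen_counit, MonoidHom.id_apply]
  exact DFunLike.congr_fun this x

end NormalClosure

section Down

variable {Γ G : Type u} [Group Γ] [Group G] (φ : Γ →* G)

/-- The composite structure map of the tower from index `j` down to index `i ≤ j`. -/
def down {i j : ℕ} (h : i ≤ j) : Tower φ j →* Tower φ i :=
  Nat.leRecOn (C := fun j => Tower φ j →* Tower φ i) h (fun {k} f => f.comp (step φ k))
    (MonoidHom.id _)

theorem down_self {i : ℕ} (x : Tower φ i) : down φ le_rfl x = x := by
  rw [down, Nat.leRecOn_self]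
  rfl

theorem down_step {i j : ℕ} (h : i ≤ j) (x : Tower φ (j + 1)) :
    down φ h (step φ j x) = down φ (h.trans j.le_succ) x := by
  conv_rhs => rw [down, Nat.leRecOn_succ h]
  rfl

theorem step_eq_down {i : ℕ} (x : Tower φ (i + 1)) : step φ i x = down φ i.le_succ x := by
  rw [← down_step φ le_rfl, down_self]

theorem down_down {i j k : ℕ} (h : i ≤ j) (h' : j ≤ k) (x : Tower φ k) :
    down φ h (down φ h' x) = down φ (h.trans h') x := by
  induction k, h' using Nat.le_induction with
  | base => rw [down_self]
  | succ k hk ih => rw [← down_step φ hk, ih, down_step]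

theorem step_towerMap (i : ℕ) (a : Γ) : step φ i (towerMap φ (i + 1) a) = towerMap φ i a :=
  NormalClosure.counit_unit (towerMap φ i) a

theorem down_towerMap {i j : ℕ} (h : i ≤ j) (a : Γ) :
    down φ h (towerMap φ j a) = towerMap φ i a := by
  induction j, h using Nat.le_induction with
  | base => rw [down_self]
  | succ j hj ih => rw [← down_step φ hj, step_towerMap, ih]

theorem down_limit (x : limit φ) {i j : ℕ} (h : i ≤ j) : down φ h (x.1 j) = x.1 i := by
  induction j, h using Nat.le_induction with
  | base => rw [down_self]
  | succ j hj ih => rw [← down_step φ hj, x.2 j, ih]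

variable {φ}

theorem TerminatesAt.down_bijective {t : ℕ} (ht : TerminatesAt φ t) {j : ℕ} (h : t ≤ j) :
    Function.Bijective (down φ h) := by
  induction j, h using Nat.le_induction with
  | base =>
    rw [show ⇑(down φ (le_refl t)) = id from funext fun x => down_self φ x]
    exact Function.bijective_id
  | succ j hj ih =>
    rw [show ⇑(down φ (hj.trans j.le_succ)) = down φ hj ∘ step φ j from
      funext fun x => (down_step φ hj x).symm]
    exact ih.comp (ht j hj)

theorem TerminatesAt.proj_bijective {t : ℕ} (ht : TerminatesAt φ t) :
    Function.Bijective (proj φ t) := by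
  refine ⟨fun x y (hxy : x.1 t = y.1 t) => Subtype.ext (funext fun i => ?_), fun y => ?_⟩
  · have htail : x.1 (i + t) = y.1 (i + t) :=
      (ht.down_bijective (Nat.le_add_left t i)).1 (by rw [down_limit, down_limit, hxy])
    rw [← down_limit φ x (Nat.le_add_right i t), htail, down_limit]
  · choose w hw using fun i : ℕ => (ht.down_bijective (Nat.le_add_left t i)).2 y
    have hstep (i : ℕ) : down φ (Nat.add_le_add_right i.le_succ t) (w (i + 1)) = w i :=
      (ht.down_bijective (Nat.le_add_left t i)).1 (by rw [down_down, hw, hw])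
    refine ⟨⟨fun i => down φ (Nat.le_add_right i t) (w i), fun i => ?_⟩, hw t⟩
    change step φ i (down φ _ (w (i + 1))) = down φ _ (w i)
    rw [step_eq_down, down_down, ← hstep i, down_down]

end Down

section TowerHom

variable {Γ Λ G H : Type u} [Group Γ] [Group Λ] [Group G] [Group H] {φ : Γ →* G} {ψ : Λ →* H}

/-- The homomorphism between the next members of two towers that is induced by a homomorphism
`F` between the members of index `i` and `j`. -/
def succHom {i j : ℕ} (p : Γ →* Λ) (F : Tower φ i →* Tower ψ j)
    (hF : ∀ a, F (towerMap φ i a) = towerMap ψ j (p a)) : Tower φ (i + 1) →* Tower ψ (j + 1) :=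
  NormalClosure.map p F hF

theorem succHom_towerMap {i j : ℕ} {p : Γ →* Λ} {F : Tower φ i →* Tower ψ j}
    (hF : ∀ a, F (towerMap φ i a) = towerMap ψ j (p a)) (a : Γ) :
    succHom p F hF (towerMap φ (i + 1) a) = towerMap ψ (j + 1) (p a) :=
  NormalClosure.map_unit hF a

theorem step_succHom {i j : ℕ} {p : Γ →* Λ} {F : Tower φ i →* Tower ψ j}
    (hF : ∀ a, F (towerMap φ i a) = towerMap ψ j (p a)) (x : Tower φ (i + 1)) :
    step ψ j (succHom p F hF x) = F (step φ i x) :=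
  NormalClosure.counit_map hF x

theorem succHom_succHom_of_eq {Ξ K : Type u} [Group Ξ] [Group K] {χ : Ξ →* K} {i j k : ℕ}
    {p : Γ →* Λ} {F : Tower φ i →* Tower ψ j} {q : Λ →* Ξ} {F' : Tower ψ j →* Tower χ k}
    {r : Γ →* Ξ} {E : Tower φ i →* Tower χ k}
    (hF : ∀ a, F (towerMap φ i a) = towerMap ψ j (p a))
    (hF' : ∀ b, F' (towerMap ψ j b) = towerMap χ k (q b))
    (hE : ∀ a, E (towerMap φ i a) = towerMap χ k (r a))
    (hr : ∀ a, q (p a) = r a) (hFE : ∀ x, F' (F x) = E x) (x : Tower φ (i + 1)) :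
    succHom q F' hF' (succHom p F hF x) = succHom r E hE x :=
  NormalClosure.map_map_of_eq hF hF' hE hr hFE x

theorem down_succ {i j : ℕ} (h : i ≤ j) (x : Tower φ (j + 1)) :
    down φ (Nat.succ_le_succ h) x =
      succHom (MonoidHom.id Γ) (down φ h) (down_towerMap φ h) x := by
  induction j, h using Nat.le_induction with
  | base =>
    rw [down_self]
    exact (NormalClosure.map_id_apply_of_eq_self _ (down_self φ) x).symm
  | succ j h ih =>
    have hstep : step φ (j + 1) x = succHom (MonoidHom.id Γ) (step φ j) (step_towerMap φ j) x :=
      NormalClosure.counit_unit_eq_map x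
    rw [← down_step φ (Nat.succ_le_succ h), ih, hstep]
    exact succHom_succHom_of_eq _ _ _ (fun _ => rfl) (down_step φ h) x

/-- The map of towers induced by a commutative square from `φ` to `ψ`, together with its
compatibility with the maps from `Γ` and `Λ`, which the recursion needs. -/
def towerHom (p : Γ →* Λ) (f : G →* H) (hf : ∀ a, f (φ a) = ψ (p a)) : ∀ i,
    {F : Tower φ i →* Tower ψ i // ∀ a, F (towerMap φ i a) = towerMap ψ i (p a)}
  | 0 => ⟨f, hf⟩
  | i + 1 => ⟨succHom p (towerHom p f hf i).1 (towerHom p f hf i).2, succHom_towerMap _⟩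

section

variable {p : Γ →* Λ} {f : G →* H} (hf : ∀ a, f (φ a) = ψ (p a))

theorem step_towerHom (i : ℕ) (x : Tower φ (i + 1)) :
    step ψ i ((towerHom p f hf (i + 1)).1 x) = (towerHom p f hf i).1 (step φ i x) :=
  step_succHom (towerHom p f hf i).2 x

theorem down_towerHom {i j : ℕ} (h : i ≤ j) (x : Tower φ j) :
    down ψ h ((towerHom p f hf j).1 x) = (towerHom p f hf i).1 (down φ h x) := by
  induction j, h using Nat.le_induction with
  | base => rw [down_self, down_self]
  | succ j hj ih => rw [← down_step ψ hj, step_towerHom, ih, down_step]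

theorem towerHom_bijective (hp : Function.Surjective p) (hker : ∀ i, p.ker ≤ (towerMap φ i).ker)
    (hbij : Function.Bijective f) (i : ℕ) : Function.Bijective (towerHom p f hf i).1 := by
  induction i with
  | zero => exact hbij
  | succ i ih => exact NormalClosure.map_bijective (towerHom p f hf i).2 hp (hker (i + 1)) ih

end

/-- The map from the tower of `φ`, shifted by `k`, to the tower of `ψ` that is induced by a
homomorphism from the member of index `k` of the former to the target of `ψ`. -/
def shiftHom {ψ : Γ →* H} (k : ℕ) (f : Tower φ k →* H) (hf : ∀ a, f (towerMap φ k a) = ψ a) : ∀ i,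
    {F : Tower φ (k + i) →* Tower ψ i // ∀ a, F (towerMap φ (k + i) a) = towerMap ψ i a}
  | 0 => ⟨f, hf⟩
  | i + 1 => ⟨succHom (MonoidHom.id Γ) (shiftHom k f hf i).1 (shiftHom k f hf i).2,
      succHom_towerMap _⟩

section

variable {ψ : Γ →* H} {k : ℕ} {f : Tower φ k →* H} (hf : ∀ a, f (towerMap φ k a) = ψ a)
  {g : H →* G} (hg : ∀ a, g (ψ a) = φ a)

theorem step_shiftHom (i : ℕ) (x : Tower φ (k + i + 1)) :
    step ψ i ((shiftHom k f hf (i + 1)).1 x) = (shiftHom k f hf i).1 (step φ (k + i) x) :=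
  step_succHom (shiftHom k f hf i).2 x

theorem towerHom_shiftHom (hgf : ∀ x, g (f x) = down φ k.zero_le x) (i : ℕ)
    (x : Tower φ (k + i)) :
    (towerHom (MonoidHom.id Γ) g hg i).1 ((shiftHom k f hf i).1 x) =
      down φ (Nat.le_add_left i k) x := by
  induction i with
  | zero => exact hgf x
  | succ i ih =>
    rw [down_succ (Nat.le_add_left i k)]
    exact succHom_succHom_of_eq (shiftHom k f hf i).2 (towerHom _ g hg i).2 (down_towerMap φ _)
      (fun _ => rfl) ih x

theorem shiftHom_towerHom (hfg : ∀ x, f ((towerHom (MonoidHom.id Γ) g hg k).1 x) =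
    down ψ k.zero_le x) (i : ℕ) (x : Tower ψ (k + i)) :
    (shiftHom k f hf i).1 ((towerHom (MonoidHom.id Γ) g hg (k + i)).1 x) =
      down ψ (Nat.le_add_left i k) x := by
  induction i with
  | zero => exact hfg x
  | succ i ih =>
    rw [down_succ (Nat.le_add_left i k)]
    exact succHom_succHom_of_eq (towerHom _ g hg (k + i)).2 (shiftHom k f hf i).2
      (down_towerMap ψ _) (fun _ => rfl) ih x

end

end TowerHom

section LimitMap

variable {Γ Λ G H : Type u} [Group Γ] [Group Λ] [Group G] [Group H] {φ : Γ →* G} {ψ : Λ →* H}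

/-- The map of inverse limits induced by a commutative square from `φ` to `ψ`. -/
def limitMap (p : Γ →* Λ) (f : G →* H) (hf : ∀ a, f (φ a) = ψ (p a)) : limit φ →* limit ψ :=
  MonoidHom.mk' (fun x => ⟨fun i => (towerHom p f hf i).1 (x.1 i),
      fun i => by rw [step_towerHom, x.2 i]⟩)
    (fun x y => Subtype.ext (funext fun i => map_mul (towerHom p f hf i).1 _ _))

theorem limitMap_toLimit {p : Γ →* Λ} {f : G →* H} (hf : ∀ a, f (φ a) = ψ (p a)) (a : Γ) :
    limitMap p f hf (toLimit φ a) = toLimit ψ (p a) :=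
  Subtype.ext (funext fun i => (towerHom p f hf i).2 a)

theorem limitMap_bijective {p : Γ →* Λ} {f : G →* H} (hf : ∀ a, f (φ a) = ψ (p a))
    (h : ∀ i, Function.Bijective (towerHom p f hf i).1) :
    Function.Bijective (limitMap p f hf) := by
  refine ⟨fun x y hxy => Subtype.ext (funext fun i => (h i).1 ?_), fun y => ?_⟩
  · exact congrFun (congrArg Subtype.val hxy) i
  · choose x hx using fun i => (h i).2 (y.1 i)
    refine ⟨⟨x, fun i => (h i).1 ?_⟩, Subtype.ext (funext hx)⟩
    rw [← step_towerHom, hx, hx, y.2 i]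

theorem limitMap_subtype_bijective (K : Subgroup G) (hK : ∀ a, φ a ∈ K) {k : ℕ}
    (hk : ∀ x, (down φ k.zero_le x : G) ∈ K) :
    Function.Bijective (limitMap (φ := φ.codRestrict K hK) (ψ := φ) (MonoidHom.id Γ) K.subtype
      fun _ => rfl) := by
  let f : Tower φ k →* K := (down φ k.zero_le).codRestrict K hk
  have hf (a : Γ) : f (towerMap φ k a) = φ.codRestrict K hK a :=
    Subtype.ext (down_towerMap φ k.zero_le a)
  refine Function.bijective_iff_has_inverse.2 ⟨fun y =>
    ⟨fun i => (shiftHom k f hf i).1 (y.1 (k + i)), fun i => ?_⟩, fun x => ?_, fun y => ?_⟩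
  · rw [step_shiftHom]
    exact congrArg _ (y.2 (k + i))
  · refine Subtype.ext (funext fun i => (shiftHom_towerHom hf (fun _ => rfl) (fun z => ?_) i
      (x.1 (k + i))).trans (down_limit _ x _))
    exact Subtype.ext (down_towerHom (ψ := φ) (f := K.subtype) (fun _ => rfl) k.zero_le z)
  · exact Subtype.ext (funext fun i => (towerHom_shiftHom hf (g := K.subtype) (fun _ => rfl)
      (fun _ => rfl) i (y.1 (k + i))).trans (down_limit φ y _))

end LimitMap

section NormallyGenerating

variable {Γ G : Type u} [Group Γ] [Group G] {φ : Γ →* G}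
  (hφ : Subgroup.normalClosure (Set.range φ) = ⊤)

theorem ker_down_le_upperCentralSeries (φ : Γ →* G) (i : ℕ) :
    (down φ i.zero_le).ker ≤ Subgroup.upperCentralSeries (Tower φ i) i := by
  induction i with
  | zero =>
    intro x hx
    rwa [MonoidHom.mem_ker, down_self] at hx
  | succ i ih =>
    have hker : (step φ i).ker ≤ Subgroup.upperCentralSeries (Tower φ (i + 1)) 1 := by
      rw [Subgroup.upperCentralSeries_one]
      exact NormalClosure.ker_counit_le_center (towerMap φ i)
    have hcomap := comap_upperCentralSeries_le (step φ i) hker i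
    rw [add_comm 1 i] at hcomap
    refine fun x hx => hcomap (ih ?_)
    rwa [MonoidHom.mem_ker, down_step]

include hφ

theorem normalClosure_range_towerMap (i : ℕ) :
    Subgroup.normalClosure (Set.range (towerMap φ i)) = ⊤ := by
  induction i with
  | zero => exact hφ
  | succ i ih => exact NormalClosure.normalClosure_range_unit (NormalClosure.counit_surjective ih)

theorem step_surjective (i : ℕ) : Function.Surjective (step φ i) :=
  NormalClosure.counit_surjective (normalClosure_range_towerMap hφ i)

theorem down_surjective {i j : ℕ} (h : i ≤ j) : Function.Surjective (down φ h) := by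
  induction j, h using Nat.le_induction with
  | base => exact fun x => ⟨x, down_self φ x⟩
  | succ j hj ih =>
    rw [show ⇑(down φ (hj.trans j.le_succ)) = down φ hj ∘ step φ j from
      funext fun x => (down_step φ hj x).symm]
    exact ih.comp (step_surjective hφ j)

variable [Finite Γ] [Finite G]

theorem finite_tower (i : ℕ) : Finite (Tower φ i) := by
  induction i with
  | zero => assumption
  | succ i ih => exact NormalClosure.finite_of_counit_surjective (step_surjective hφ i)

theorem card_tower_le (i : ℕ) :
    (Nat.card (Tower φ i) : ℝ) ≤ Nat.card Γ * sizeBound (Nat.card G) :=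
  have := finite_tower hφ i
  card_le_mul_sizeBound (normalClosure_range_towerMap hφ i) (down_surjective hφ i.zero_le)
    (ker_down_le_upperCentralSeries φ i)

theorem exists_terminatesAt : ∃ t, TerminatesAt φ t := by
  have hfin := finite_tower hφ
  have hmono : Monotone fun i => Nat.card (Tower φ i) := fun i j hij =>
    Nat.card_le_card_of_surjective _ (down_surjective hφ hij)
  obtain ⟨c, t, hc⟩ := converges_of_monotone_of_bounded hmono fun i =>
    Nat.le_floor (card_tower_le hφ i)
  refine ⟨t, fun i hi => (step_surjective hφ i).bijective_of_nat_card_le ?_⟩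
  exact ((hc (i + 1) (hi.trans i.le_succ)).trans (hc i hi).symm).le

theorem finite_limit : Finite (limit φ) :=
  have ⟨t, ht⟩ := exists_terminatesAt hφ
  have := finite_tower hφ t
  Finite.of_injective _ ht.proj_bijective.1

theorem card_limit_le : (Nat.card (limit φ) : ℝ) ≤ Nat.card Γ * sizeBound (Nat.card G) := by
  obtain ⟨t, ht⟩ := exists_terminatesAt hφ
  rw [Nat.card_congr (Equiv.ofBijective _ ht.proj_bijective)]
  exact card_tower_le hφ t

end NormallyGenerating

section Series

variable {Γ : Type u} {G : Type v} [Group Γ] [Group G] (φ : Γ →* G)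

theorem closureSeries_antitone (H : Subgroup G) : Antitone (closureSeries H) := by
  refine antitone_nat_of_succ_le fun i => ?_
  induction i with
  | zero => exact le_top
  | succ i ih =>
    refine Subgroup.closure_mono ?_
    rintro _ ⟨c, hc, h, hh, rfl⟩
    exact ⟨c, ih hc, h, hh, rfl⟩

theorem kerSeries_antitone : Antitone (kerSeries φ) := by
  refine antitone_nat_of_succ_le fun i => ?_
  have := kerSeries_normal φ i
  exact Subgroup.commutator_le_right _ _

theorem inducedPsi_mk' (a : Γ) : MonoidHom.id (subnormalClosure φ) (inducedRho φ a) =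
    inducedPsi φ (QuotientGroup.mk' (kerTerminal φ) a) :=
  rfl

theorem kerSeries_inducedRho (i : ℕ) : kerSeries (inducedRho φ) i = kerSeries φ i := by
  induction i with
  | zero => exact MonoidHom.ker_codRestrict φ _ _
  | succ i ih => rw [kerSeries, ih, kerSeries]

theorem normalClosure_range_inducedRho [Finite G] :
    Subgroup.normalClosure (Set.range (inducedRho φ)) = ⊤ := by
  obtain ⟨t, ht⟩ := exists_forall_ge_eq_iInf (closureSeries_antitone φ.range)
  have h : subnormalClosure φ ≤ (Subgroup.normalClosure (Set.range (inducedRho φ))).map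
      (subnormalClosure φ).subtype := by
    refine (ht (t + 1) t.le_succ).ge.trans ((Subgroup.closure_le _).2 ?_)
    rintro _ ⟨c, hc, _, ⟨a, rfl⟩, rfl⟩
    rw [ht t le_rfl] at hc
    exact ⟨⟨c, hc⟩ * inducedRho φ a * ⟨c, hc⟩⁻¹, Subgroup.normalClosure_normal.conj_mem _
      (Subgroup.subset_normalClosure (Set.mem_range_self a)) _, rfl⟩
  refine top_le_iff.1 fun x _ => ?_
  obtain ⟨y, hy, hyx⟩ := h x.2
  exact Subtype.ext hyx ▸ hy

theorem normalClosure_range_inducedPsi [Finite G] :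
    Subgroup.normalClosure (Set.range (inducedPsi φ)) = ⊤ := by
  rw [← top_le_iff, ← normalClosure_range_inducedRho φ]
  refine Subgroup.normalClosure_mono ?_
  rintro _ ⟨a, rfl⟩
  exact ⟨a, rfl⟩

end Series

section TowerSeries

variable {Γ G : Type u} [Group Γ] [Group G] (φ : Γ →* G)

theorem down_mem_closureSeries (k : ℕ) (x : Tower φ k) :
    (down φ k.zero_le x : G) ∈ closureSeries φ.range k := by
  induction k with
  | zero => exact Subgroup.mem_top _
  | succ k ih =>
    have h : (closureSeries φ.range (k + 1)).comap
        (down φ (k + 1).zero_le : Tower φ (k + 1) →* G) = ⊤ := by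
      refine NormalClosure.eq_top_of_gen_mem (towerMap φ k) fun y a => ?_
      have hstep : step φ k (NormalClosure.gen (towerMap φ k) y a) = y * towerMap φ k a * y⁻¹ :=
        NormalClosure.counit_gen (towerMap φ k) y a
      refine Subgroup.subset_closure ⟨down φ k.zero_le y, ih y, φ a, ⟨a, rfl⟩, ?_⟩
      refine (down_step φ k.zero_le _).symm.trans ?_
      rw [hstep, map_mul, map_mul, map_inv, down_towerMap]
      rfl
    exact Subgroup.mem_comap.1 (h ▸ Subgroup.mem_top x)

theorem kerSeries_le_ker_towerMap (i : ℕ) : kerSeries φ i ≤ (towerMap φ i).ker := by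
  induction i with
  | zero => exact le_rfl
  | succ i ih => exact NormalClosure.commutator_le_ker_unit ih

theorem kerTerminal_le_ker_towerMap_inducedRho (i : ℕ) :
    kerTerminal φ ≤ (towerMap (inducedRho φ) i).ker := by
  refine (iInf_le _ i).trans ?_
  rw [← kerSeries_inducedRho]
  exact kerSeries_le_ker_towerMap (inducedRho φ) i

/-- The isomorphisms `Γ_{i+1,ρ} ≅ (Γ/𝒦)_{i+1,ψ}`. -/
def towerEquiv (i : ℕ) : Tower (inducedRho φ) i ≃* Tower (inducedPsi φ) i :=
  MulEquiv.ofBijective _ <| towerHom_bijective (inducedPsi_mk' φ) (QuotientGroup.mk'_surjective _)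
    (fun j => (QuotientGroup.ker_mk' _).le.trans (kerTerminal_le_ker_towerMap_inducedRho φ j))
    Function.bijective_id i

theorem towerEquiv_zero : towerEquiv φ 0 = MulEquiv.refl (subnormalClosure φ) :=
  MulEquiv.ext fun _ => rfl

theorem towerEquiv_step (i : ℕ) (x : Tower (inducedRho φ) (i + 1)) :
    towerEquiv φ i (step (inducedRho φ) i x) = step (inducedPsi φ) i (towerEquiv φ (i + 1) x) :=
  (step_towerHom (inducedPsi_mk' φ) i x).symm

theorem towerEquiv_towerMap (i : ℕ) (a : Γ) : towerEquiv φ i (towerMap (inducedRho φ) i a) =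
    towerMap (inducedPsi φ) i (a : Γ ⧸ kerTerminal φ) :=
  (towerHom _ _ (inducedPsi_mk' φ) i).2 a

/-- The isomorphism `Γ_{∞,ρ} ≅ (Γ/𝒦)_{∞,ψ}` induced by `towerEquiv`. -/
def limitRhoEquivPsi : limit (inducedRho φ) ≃* limit (inducedPsi φ) :=
  MulEquiv.ofBijective _ <|
    limitMap_bijective (inducedPsi_mk' φ) fun i => (towerEquiv φ i).bijective

variable [Finite G]

/-- The isomorphism `Γ_{∞,ρ} ≅ Γ_{∞,φ}` induced by the inclusion `𝒞 ≤ G`. -/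
def limitRhoEquiv : limit (inducedRho φ) ≃* limit φ :=
  MulEquiv.ofBijective (limitMap (MonoidHom.id Γ) (subnormalClosure φ).subtype fun _ => rfl) <| by
    obtain ⟨k, hk⟩ := exists_forall_ge_eq_iInf (closureSeries_antitone φ.range)
    exact limitMap_subtype_bijective _ (mem_subnormalClosure φ) (k := k)
      fun x => (hk k le_rfl).le (down_mem_closureSeries φ k x)

theorem limitRhoEquiv_symm_toLimit (a : Γ) :
    (limitRhoEquiv φ).symm (toLimit φ a) = toLimit (inducedRho φ) a :=
  (MulEquiv.symm_apply_eq _).2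
    (limitMap_toLimit (f := (subnormalClosure φ).subtype) (p := MonoidHom.id Γ)
      (fun _ => rfl) a).symm

theorem toBase_limitRhoEquiv_symm (x : limit φ) :
    (toBase (inducedRho φ) ((limitRhoEquiv φ).symm x) : G) = toBase φ x :=
  congrArg (toBase φ) ((limitRhoEquiv φ).apply_symm_apply x)

end TowerSeries

end SubnormalTower

end

open SubnormalTower in
theorem theorem2 {Γ G : Type u} [Group Γ] [Group G] [Finite Γ] [Finite G] (φ : Γ →* G) :
    -- the series defining `𝒞` and `𝒦` terminate, with terminal members `𝒞` and `𝒦`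
    (∃ t, ∀ i, t ≤ i → closureSeries φ.range i = subnormalClosure φ) ∧
    (∃ t, ∀ i, t ≤ i → kerSeries φ i = kerTerminal φ) ∧
    -- (1) `Γ_{∞,φ} ≅ Γ_{∞,ρ}`, compatibly with the maps from `Γ` and the maps to `G`
    (∃ e₁ : limit φ ≃* limit (inducedRho φ),
      (∀ a, e₁ (toLimit φ a) = toLimit (inducedRho φ) a) ∧
      (∀ x, (toBase (inducedRho φ) (e₁ x) : G) = toBase φ x) ∧
      -- `Γ_{∞,ρ} = (Γ/𝒦)_{∞,ψ}`: the two towers are identified by isomorphisms that are the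
      -- identity on `𝒞` and are compatible with all the maps of the towers
      ∃ f : ∀ i, Tower (inducedRho φ) i ≃* Tower (inducedPsi φ) i,
        f 0 = MulEquiv.refl (subnormalClosure φ) ∧
        (∀ i x, f i (step (inducedRho φ) i x) = step (inducedPsi φ) i (f (i + 1) x)) ∧
        (∀ i a, f i (towerMap (inducedRho φ) i a) =
          towerMap (inducedPsi φ) i (a : Γ ⧸ kerTerminal φ)) ∧
        ∃ e₂ : limit (inducedRho φ) ≃* limit (inducedPsi φ),
          (∀ i x, proj (inducedPsi φ) i (e₂ x) = f i (proj (inducedRho φ) i x)) ∧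
          -- (2) both towers terminate, and `Γ_{∞,φ}` is isomorphic to their terminal members
          (∃ t₁, TerminatesAt (inducedRho φ) t₁) ∧
          (∃ t₂, TerminatesAt (inducedPsi φ) t₂) ∧
          (∀ t₁, TerminatesAt (inducedRho φ) t₁ →
            ∃ u₁ : limit φ ≃* Tower (inducedRho φ) t₁,
              ∀ x, u₁ x = proj (inducedRho φ) t₁ (e₁ x)) ∧
          (∀ t₂, TerminatesAt (inducedPsi φ) t₂ →
            ∃ u₂ : limit φ ≃* Tower (inducedPsi φ) t₂,
              ∀ x, u₂ x = proj (inducedPsi φ) t₂ (e₂ (e₁ x)))) ∧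
    -- (3) finiteness and the bound on the order
    Finite (limit φ) ∧
    (Nat.card (limit φ) : ℝ) ≤
      (Nat.card (Γ ⧸ kerTerminal φ) : ℝ) * sizeBound (Nat.card (subnormalClosure φ)) := by
  have hρ := normalClosure_range_inducedRho φ
  have hψ := normalClosure_range_inducedPsi φ
  let e₁ : limit φ ≃* limit (inducedRho φ) := (limitRhoEquiv φ).symm
  let e₂ : limit (inducedRho φ) ≃* limit (inducedPsi φ) := limitRhoEquivPsi φ
  refine ⟨exists_forall_ge_eq_iInf (closureSeries_antitone φ.range),
    exists_forall_ge_eq_iInf (kerSeries_antitone φ),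
    ⟨e₁, limitRhoEquiv_symm_toLimit φ, toBase_limitRhoEquiv_symm φ,
      towerEquiv φ, towerEquiv_zero φ, towerEquiv_step φ, towerEquiv_towerMap φ,
      e₂, fun _ _ => rfl, exists_terminatesAt hρ, exists_terminatesAt hψ, fun t₁ ht₁ => ?_,
      fun t₂ ht₂ => ?_⟩, ?_, ?_⟩
  · exact ⟨e₁.trans (MulEquiv.ofBijective _ ht₁.proj_bijective), fun _ => rfl⟩
  · exact ⟨(e₁.trans e₂).trans (MulEquiv.ofBijective _ ht₂.proj_bijective), fun _ => rfl⟩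
  · have := finite_limit hρ
    exact Finite.of_equiv _ e₁.symm.toEquiv
  · rw [Nat.card_congr (e₁.trans e₂).toEquiv]
    exact card_limit_le hψ
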